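/- Let $\alpha>2$ and $0<N_1\le N_2$. In the Variable-Rate Random Access Game network $i\in\{1,2\}$ chooses $\Lambda_i\in[0,N_i]$ and receives the payoff $$U_i(\Lambda_1,\Lambda_2)=\Lambda_i\int_0^\infty e^{-(\Lambda_1+\Lambda_2)x^{2/\alpha}}\,\frac{dx}{1+x},$$ with $U_i(0,0)=0$. A (pure) Nash equilibrium is a pair $(\Lambda_1^*,\Lambda_2^*)\in[0,N_1]\times[0,N_2]$ at which neither network can increase its own payoff by changing only its own $\Lambda_i$. (a) If $\alpha>4$, the equation $$\int_0^\infty\frac{1-\Lambda x^{2/\alpha}}{1+x}\,e^{-2\Lambda x^{2/\alpha}}\,dx=0$$ (convergence of the integral being required) has a unique real solution $\Lambda$, and it is positive; denote it by $\Lambda''(\alpha)$. If $\alpha\le 4$, the equation has no solution, and we put $\Lambda''(\alpha)=+\infty$. (b) The equation $$\int_0^\infty\frac{1-\Lambda x^{2/\alpha}}{1+x}\,e^{-(N_1+\Lambda)x^{2/\alpha}}\,dx=0$$ (convergence of the integral being required) has a unique real solution $\Lambda$, and it is positive; denote it by $\Lambda_r$. (c) The game has exactly one Nash equilibrium $(\Lambda_1^*,\Lambda_2^*)$,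 and it is given as follows. - (Full/Full reuse) If $N_1\le\Lambda''(\alpha)$ and $N_2\le\Lambda_r$, then $(\Lambda_1^*,\Lambda_2^*)=(N_1,N_2)$. - (Full/Partial reuse) If $N_1\le\Lambda''(\alpha)$ and $N_2>\Lambda_r$, then $(\Lambda_1^*,\Lambda_2^*)=(N_1,\Lambda_r)$. - (Partial/Partial reuse) If $N_1>\Lambda''(\alpha)$, then $(\Lambda_1^*,\Lambda_2^*)=(\Lambda''(\alpha),\Lambda''(\alpha))$. -/

import Mathlib

open MeasureTheory Set

/-- The integral `∫₀^∞ e^{-S x^{2/α}} / (1+x) dx`, where `S` is the total transmit density. It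
converges for every `S > 0` (see `integrableOn_rate`). -/
noncomputable def rateIntegral (α S : ℝ) : ℝ :=
  ∫ x in Ioi (0 : ℝ), Real.exp (-S * x ^ (2 / α)) / (1 + x)

/-- Payoff of network 1. At `Λ₁ = Λ₂ = 0`, the only pair of nonnegative densities at which the
integral diverges, no network transmits and the payoff is `0`. -/
noncomputable def payoff₁ (α Λ₁ Λ₂ : ℝ) : ℝ := Λ₁ * rateIntegral α (Λ₁ + Λ₂)

/-- Payoff of network 2 (with value `0` at `Λ₁ = Λ₂ = 0`, as for network 1). -/
noncomputable def payoff₂ (α Λ₁ Λ₂ : ℝ) : ℝ := Λ₂ * rateIntegral α (Λ₁ + Λ₂)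

/-- `(Λ₁, Λ₂)` is a (pure) Nash equilibrium of the Variable-Rate Random Access Game in which
network `i` chooses `Λᵢ ∈ [0, Nᵢ]`. -/
structure IsVariableRateNash (α N₁ N₂ : ℝ) (P : ℝ × ℝ) : Prop where
  mem₁ : P.1 ∈ Icc 0 N₁
  mem₂ : P.2 ∈ Icc 0 N₂
  best₁ : ∀ s ∈ Icc 0 N₁, payoff₁ α s P.2 ≤ payoff₁ α P.1 P.2
  best₂ : ∀ s ∈ Icc 0 N₂, payoff₂ α P.1 s ≤ payoff₂ α P.1 P.2

/-- The equation `∫₀^∞ (1 - Λ x^{2/α}) / (1+x) · e^{-S x^{2/α}} dx = 0`, where the integral is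
required to converge. -/
def ZeroIntegral (α S Λ : ℝ) : Prop :=
  IntegrableOn (fun x : ℝ => (1 - Λ * x ^ (2 / α)) / (1 + x) * Real.exp (-S * x ^ (2 / α)))
      (Ioi 0) ∧
    ∫ x in Ioi (0 : ℝ), (1 - Λ * x ^ (2 / α)) / (1 + x) * Real.exp (-S * x ^ (2 / α)) = 0

/-- The equation defining `Λ''(α)`. -/
def SolvesSymmetricEq (α Λ : ℝ) : Prop := ZeroIntegral α (2 * Λ) Λ

/-- The equation, over `Λ`, that decides between full and partial reuse for network 2 when network
1 uses density `N₁`. -/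
def SolvesResponseEq (α N₁ Λ : ℝ) : Prop := ZeroIntegral α (N₁ + Λ) Λ

/-- The integral in the payoffs converges whenever the total density is positive. -/
theorem integrableOn_rate {α S : ℝ} (hα : 2 < α) (hS : 0 < S) :
    IntegrableOn (fun x : ℝ => Real.exp (-S * x ^ (2 / α)) / (1 + x)) (Ioi 0) := by
  have hp : 0 < 2 / α := by positivity
  have h : IntegrableOn (fun x : ℝ => Real.exp (-S * x ^ (2 / α))) (Ioi 0) := by
    by_contra hn
    have h0 := integral_exp_neg_mul_rpow hp hS
    rw [integral_undef hn] at h0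
    have : 0 < S ^ (-1 / (2 / α)) * Real.Gamma (1 / (2 / α) + 1) := by
      have := Real.Gamma_pos_of_pos (s := 1 / (2 / α) + 1) (by positivity)
      positivity
    linarith
  refine Integrable.mono' h (Measurable.aestronglyMeasurable (by fun_prop)) ?_
  filter_upwards [ae_restrict_mem measurableSet_Ioi] with x hx
  have hx' : (0 : ℝ) < x := hx
  rw [Real.norm_of_nonneg (by positivity)]
  exact div_le_self (Real.exp_pos _).le (by linarith)

/-! Put `p = 2 / α`. The marginal payoff of `Λ` against `N` is `∫ (1 - Λ x^p) e^{-(N + Λ) x^p} / (1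
+ x)`; the symmetric equation is the same expression with `N = 0` and `2Λ` in the exponent, so
`marginal` carries a factor `k`. Substituting `y = c x` with `c = Λ^{1/p}` and multiplying by `(1 +
c) e^{N/Λ}` gives an integrand that decreases in `Λ` at every `y ≠ 1` (`strictAntiOn_marginal`), so
`marginal` changes sign at most once, from plus to minus. It is positive for some small `Λ`. For
large `Λ` its sign is governed by `∫ (1 - y^p) e^{-k y^p}`, a positive multiple of `1 - 1/(p k)`.
Hence a zero always exists for `k = 1`, and for `k = 2` exactly when `α > 4`. Best responses are
therefore `min (r N) M`. At a common total density both players' marginals are built from the same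
two moments, and the larger density has the smaller marginal; this comparison yields the equilibrium
(`nash_cases`). -/

namespace VariableRate

open Real Filter Topology

/-! ### Moments: positivity and differentiation in the total density. -/

/-- The integral `∫₀^∞ x^q e^{-S x^p} / (1+x) dx`. -/
noncomputable def moment (p q S : ℝ) : ℝ :=
  ∫ x in Ioi (0 : ℝ), x ^ q * exp (-S * x ^ p) / (1 + x)

/-- With `S = N + k Λ`, the integral `∫₀^∞ (1 - Λ x^p) e^{-S x^p} / (1+x) dx`. For `k = 1` this is
the marginal payoff of density `Λ` against density `N`. -/
noncomputable def marginal (p N k Λ : ℝ) : ℝ :=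
  moment p 0 (N + k * Λ) - Λ * moment p p (N + k * Λ)

theorem integrableOn_moment {p q S : ℝ} (hp : 0 < p) (hq : 0 ≤ q) (hS : 0 < S) :
    IntegrableOn (fun x : ℝ => x ^ q * exp (-S * x ^ p) / (1 + x)) (Ioi 0) := by
  refine Integrable.mono' (integrableOn_rpow_mul_exp_neg_mul_rpow (p := p) (s := q) (b := S)
    (by linarith) hp hS) (Measurable.aestronglyMeasurable (by fun_prop)) ?_
  filter_upwards [ae_restrict_mem measurableSet_Ioi] with x hx
  have hx' : (0 : ℝ) < x := hx
  rw [Real.norm_of_nonneg (by positivity)]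
  exact div_le_self (by positivity) (by linarith)

/-- The point `1` is exempt because the integrands compared later contain the factor `1 - y ^ p`. -/
theorem setIntegral_Ioi_pos {f : ℝ → ℝ} (hf : IntegrableOn f (Ioi 0))
    (hpos : ∀ x, 0 < x → x ≠ 1 → 0 < f x) : 0 < ∫ x in Ioi (0 : ℝ), f x := by
  have h1 : ∀ᵐ x : ℝ, x ≠ 1 := by simp [ae_iff]
  rw [setIntegral_pos_iff_support_of_nonneg_ae _ hf]
  · refine lt_of_lt_of_le ?_ (measure_mono (s := Ioo (2 : ℝ) 3) ?_)
    · norm_num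
    · intro x hx
      exact ⟨(hpos x (by linarith [hx.1]) (by linarith [hx.1])).ne', by
        show (0 : ℝ) < x
        linarith [hx.1]⟩
  · filter_upwards [ae_restrict_mem measurableSet_Ioi, ae_restrict_of_ae h1] with x hx hx1
    exact (hpos x hx hx1).le

theorem setIntegral_Ioi_lt {f g : ℝ → ℝ} (hf : IntegrableOn f (Ioi 0))
    (hg : IntegrableOn g (Ioi 0)) (hlt : ∀ x, 0 < x → x ≠ 1 → f x < g x) :
    ∫ x in Ioi (0 : ℝ), f x < ∫ x in Ioi (0 : ℝ), g x := by
  rw [← sub_pos, ← integral_sub hg hf]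
  exact setIntegral_Ioi_pos (hg.sub hf) fun x hx hx1 => sub_pos.2 (hlt x hx hx1)

theorem moment_pos {p q S : ℝ} (hp : 0 < p) (hq : 0 ≤ q) (hS : 0 < S) : 0 < moment p q S :=
  setIntegral_Ioi_pos (integrableOn_moment hp hq hS) fun x hx _ => by positivity

theorem hasDerivAt_moment {p q S : ℝ} (hp : 0 < p) (hq : 0 ≤ q) (hS : 0 < S) :
    HasDerivAt (moment p q) (-moment p (q + p) S) S := by
  -- For `s > S / 2` the derivative in `s` is dominated by its size at `S / 2`.
  have key := (hasDerivAt_integral_of_dominated_loc_of_deriv_le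
    (μ := volume.restrict (Ioi (0 : ℝ))) (s := Ioi (S / 2)) (x₀ := S)
    (F := fun s x => x ^ q * exp (-s * x ^ p) / (1 + x))
    (F' := fun s x => -(x ^ (q + p) * exp (-s * x ^ p) / (1 + x)))
    (bound := fun x => x ^ (q + p) * exp (-(S / 2) * x ^ p) / (1 + x))
    (Ioi_mem_nhds (by linarith))
    (Eventually.of_forall fun s => Measurable.aestronglyMeasurable (by fun_prop))
    (integrableOn_moment hp hq hS) (Measurable.aestronglyMeasurable (by fun_prop)) ?_
    (integrableOn_moment hp (by linarith) (by linarith)) ?_).2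
  · rw [integral_neg] at key
    exact key
  · filter_upwards [ae_restrict_mem measurableSet_Ioi] with x hx s hs
    have hx' : (0 : ℝ) < x := hx
    have hs' : S / 2 < s := hs
    rw [norm_neg, Real.norm_of_nonneg (by positivity)]
    gcongr
  · filter_upwards [ae_restrict_mem measurableSet_Ioi] with x hx s _
    have hx' : (0 : ℝ) < x := hx
    have h := (((hasDerivAt_id s).neg.mul_const (x ^ p)).exp.const_mul (x ^ q)).div_const (1 + x)
    refine h.congr_deriv ?_
    rw [rpow_add hx']
    simp only [id, Pi.neg_apply]
    ring

/-! ### Rescaling and monotonicity of the marginal. -/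

theorem marginal_eq_setIntegral {p N k Λ : ℝ} (hp : 0 < p) (hS : 0 < N + k * Λ) :
    IntegrableOn (fun x : ℝ => (1 - Λ * x ^ p) / (1 + x) * exp (-(N + k * Λ) * x ^ p)) (Ioi 0) ∧
    ∫ x in Ioi (0 : ℝ), (1 - Λ * x ^ p) / (1 + x) * exp (-(N + k * Λ) * x ^ p)
      = marginal p N k Λ := by
  have h0 := integrableOn_moment hp le_rfl hS
  have h1 := (integrableOn_moment hp hp.le hS).const_mul Λ
  have heq : (fun x : ℝ => (1 - Λ * x ^ p) / (1 + x) * exp (-(N + k * Λ) * x ^ p)) =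
      fun x => x ^ (0 : ℝ) * exp (-(N + k * Λ) * x ^ p) / (1 + x)
        - Λ * (x ^ p * exp (-(N + k * Λ) * x ^ p) / (1 + x)) := by
    ext x
    rw [rpow_zero]
    ring
  rw [heq]
  refine ⟨h0.sub h1, ?_⟩
  rw [integral_sub h0 h1, integral_const_mul]
  rfl

theorem marginal_eq_scaled {p N k Λ : ℝ} (hp : 0 < p) (hΛ : 0 < Λ) (hS : 0 < N + k * Λ) :
    IntegrableOn (fun y : ℝ => (1 - y ^ p) * exp (-(N / Λ + k) * y ^ p) / (Λ ^ p⁻¹ + y)) (Ioi 0) ∧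
    ∫ y in Ioi (0 : ℝ), (1 - y ^ p) * exp (-(N / Λ + k) * y ^ p) / (Λ ^ p⁻¹ + y)
      = marginal p N k Λ := by
  obtain ⟨hi, he⟩ := marginal_eq_setIntegral hp hS
  set c := Λ ^ p⁻¹ with hc
  have hc0 : 0 < c := rpow_pos_of_pos hΛ _
  have hcp : c ^ p = Λ := by rw [hc, ← rpow_mul hΛ.le, inv_mul_cancel₀ hp.ne', rpow_one]
  set g : ℝ → ℝ := fun y => (1 - y ^ p) * exp (-(N / Λ + k) * y ^ p) / (c + y) with hg
  have hgc : ∀ x ∈ Ioi (0 : ℝ), g (c * x)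
      = c⁻¹ * ((1 - Λ * x ^ p) / (1 + x) * exp (-(N + k * Λ) * x ^ p)) := by
    intro x hx
    have hx' : (0 : ℝ) < x := hx
    have h1 : -(N / Λ + k) * (Λ * x ^ p) = -(N + k * Λ) * x ^ p := by field_simp
    simp only [hg]
    rw [mul_rpow hc0.le hx'.le, hcp, h1]
    field_simp
  constructor
  · have := integrableOn_Ioi_comp_mul_left_iff g 0 hc0
    rw [mul_zero] at this
    rw [← this]
    exact (integrableOn_congr_fun hgc measurableSet_Ioi).2 (hi.const_mul _)
  · have := integral_comp_mul_left_Ioi' g 0 hc0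
    rw [mul_zero] at this
    rw [← this, setIntegral_congr_fun measurableSet_Ioi hgc, integral_const_mul, he, smul_eq_mul]
    field_simp

/-- The weight is `1 + (1 - y) / (c + y)`: decreasing in `c` for `y < 1`, increasing for `y > 1`. A
factor `t` with the sign of `1 - y` makes it decreasing in both cases. -/
theorem mul_one_add_div_add_lt {y c c' : ℝ} (hy : 0 < y) (hc : 0 < c) (hcc : c < c') (t : ℝ)
    (ht : y < 1 ∧ 0 < t ∨ 1 < y ∧ t < 0) :
    t * ((1 + c') / (c' + y)) < t * ((1 + c) / (c + y)) := by
  rcases ht with ⟨h1, h2⟩ | ⟨h1, h2⟩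
  · refine mul_lt_mul_of_pos_left ?_ h2
    rw [div_lt_div_iff₀ (by linarith) (by linarith)]
    nlinarith
  · refine mul_lt_mul_of_neg_left ?_ h2
    rw [div_lt_div_iff₀ (by linarith) (by linarith)]
    nlinarith

theorem one_sub_rpow_sign {p y : ℝ} (hp : 0 < p) (hy : 0 < y) (hy1 : y ≠ 1) :
    y < 1 ∧ 0 < 1 - y ^ p ∨ 1 < y ∧ 1 - y ^ p < 0 := by
  rcases lt_or_gt_of_ne hy1 with h | h
  · exact Or.inl ⟨h, sub_pos.2 (rpow_lt_one hy.le h hp)⟩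
  · exact Or.inr ⟨h, sub_neg.2 (one_lt_rpow h hp)⟩

/-- The derivative in `a` is `t² e^{at} ≥ 0`. Used with `t = 1 - y ^ p` and `a = N / Λ`. -/
theorem mul_exp_mul_le {t a b : ℝ} (hab : a ≤ b) : t * exp (a * t) ≤ t * exp (b * t) := by
  rcases le_total 0 t with h | h
  · exact mul_le_mul_of_nonneg_left (exp_le_exp.2 (mul_le_mul_of_nonneg_right hab h)) h
  · exact mul_le_mul_of_nonpos_left (exp_le_exp.2 (mul_le_mul_of_nonpos_right hab h)) h

/-- After multiplication by a positive factor, `marginal` is strictly decreasing in the density. -/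
theorem strictAntiOn_marginal {p N k : ℝ} (hp : 0 < p) (hN : 0 ≤ N) (hk : 0 < k) :
    StrictAntiOn (fun Λ => ((1 + Λ ^ p⁻¹) * exp (N / Λ)) * marginal p N k Λ) (Ioi 0) := by
  have hrew : ∀ Λ : ℝ, 0 < Λ →
      IntegrableOn (fun y : ℝ => ((1 - y ^ p) * exp (N / Λ * (1 - y ^ p))) * exp (-k * y ^ p)
        * ((1 + Λ ^ p⁻¹) / (Λ ^ p⁻¹ + y))) (Ioi 0) ∧
      ∫ y in Ioi (0 : ℝ), ((1 - y ^ p) * exp (N / Λ * (1 - y ^ p))) * exp (-k * y ^ p)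
        * ((1 + Λ ^ p⁻¹) / (Λ ^ p⁻¹ + y)) =
      ((1 + Λ ^ p⁻¹) * exp (N / Λ)) * marginal p N k Λ := by
    intro Λ hΛ
    obtain ⟨hi, he⟩ := marginal_eq_scaled (p := p) (N := N) (k := k) hp hΛ (by positivity)
    have heq : (fun y : ℝ => ((1 - y ^ p) * exp (N / Λ * (1 - y ^ p))) * exp (-k * y ^ p)
        * ((1 + Λ ^ p⁻¹) / (Λ ^ p⁻¹ + y))) = fun y => ((1 + Λ ^ p⁻¹) * exp (N / Λ)) *
          ((1 - y ^ p) * exp (-(N / Λ + k) * y ^ p) / (Λ ^ p⁻¹ + y)) := by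
      ext y
      have h1 : exp (N / Λ * (1 - y ^ p)) * exp (-k * y ^ p)
          = exp (N / Λ) * exp (-(N / Λ + k) * y ^ p) := by
        rw [← exp_add, ← exp_add]
        ring_nf
      linear_combination (1 - y ^ p) * ((1 + Λ ^ p⁻¹) / (Λ ^ p⁻¹ + y)) * h1
    rw [heq, integral_const_mul, he]
    exact ⟨hi.const_mul _, rfl⟩
  intro a ha b hb hab
  have ha' : (0 : ℝ) < a := ha
  have hb' : (0 : ℝ) < b := hb
  simp only
  rw [← (hrew a ha).2, ← (hrew b hb).2]
  refine setIntegral_Ioi_lt (hrew b hb).1 (hrew a ha).1 fun y hy hy1 => ?_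
  have hcc : a ^ p⁻¹ < b ^ p⁻¹ := rpow_lt_rpow ha'.le hab (by positivity)
  have hca : 0 < a ^ p⁻¹ := rpow_pos_of_pos ha' _
  -- Strictness comes from the rational weight; the factor with `N / Λ` is constant when `N = 0`.
  refine lt_of_lt_of_le (mul_one_add_div_add_lt hy hca hcc _ ?_) ?_
  · rcases one_sub_rpow_sign hp hy hy1 with ⟨h1, h2⟩ | ⟨h1, h2⟩
    · exact Or.inl ⟨h1, by positivity⟩
    · exact Or.inr ⟨h1, mul_neg_of_neg_of_pos (mul_neg_of_neg_of_pos h2 (exp_pos _)) (exp_pos _)⟩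
  · have : N / b ≤ N / a := div_le_div_of_nonneg_left hN ha' hab.le
    have := mul_exp_mul_le (t := 1 - y ^ p) this
    gcongr

theorem marginal_neg_of_lt {p N k a b : ℝ} (hp : 0 < p) (hN : 0 ≤ N) (hk : 0 < k) (ha : 0 < a)
    (hab : a < b) (h : marginal p N k a ≤ 0) : marginal p N k b < 0 := by
  have h1 := strictAntiOn_marginal hp hN hk ha (ha.trans hab) hab
  have ha1 : 0 < (1 + a ^ p⁻¹) * exp (N / a) := by positivity
  have hb0 : 0 < b := ha.trans hab
  have hb1 : 0 < (1 + b ^ p⁻¹) * exp (N / b) := by positivity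
  have h2 := mul_nonpos_of_nonneg_of_nonpos ha1.le h
  simp only at h1
  by_contra! h3
  have := mul_nonneg hb1.le h3
  linarith

theorem continuousOn_marginal {p N k : ℝ} (hp : 0 < p) {s : Set ℝ}
    (hs : ∀ Λ ∈ s, 0 < N + k * Λ) : ContinuousOn (marginal p N k) s := by
  have h : ∀ q : ℝ, 0 ≤ q → ContinuousOn (fun Λ => moment p q (N + k * Λ)) s := by
    intro q hq Λ hΛ
    have h1 : ContinuousAt (moment p q) (N + k * Λ) :=
      (hasDerivAt_moment hp hq (hs Λ hΛ)).continuousAt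
    exact (ContinuousAt.comp (f := fun Λ => N + k * Λ) h1 (by fun_prop)).continuousWithinAt
  exact (h 0 le_rfl).sub (continuousOn_id.mul (h p hp.le))

/-! ### Large densities and the threshold `p * k = 1`. -/

theorem setIntegral_one_sub_rpow_mul_exp {p k : ℝ} (hp : 0 < p) (hk : 0 < k) :
    IntegrableOn (fun y : ℝ => (1 - y ^ p) * exp (-k * y ^ p)) (Ioi 0) ∧
    ∫ y in Ioi (0 : ℝ), (1 - y ^ p) * exp (-k * y ^ p)
      = k ^ (-1 / p) * Gamma (1 / p + 1) * (1 - 1 / p / k) := by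
  have h0 := integrableOn_rpow_mul_exp_neg_mul_rpow (p := p) (s := 0) (b := k)
    (by norm_num) hp hk
  have h1 := integrableOn_rpow_mul_exp_neg_mul_rpow (p := p) (s := p) (b := k)
    (by linarith) hp hk
  have heq : (fun y : ℝ => (1 - y ^ p) * exp (-k * y ^ p)) =
      fun y => y ^ (0 : ℝ) * exp (-k * y ^ p) - y ^ p * exp (-k * y ^ p) := by
    ext y
    rw [rpow_zero]
    ring
  rw [heq]
  refine ⟨h0.sub h1, ?_⟩
  rw [integral_sub h0 h1, integral_rpow_mul_exp_neg_mul_rpow hp (by linarith : -1 < p) hk]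
  simp only [rpow_zero, one_mul]
  rw [integral_exp_neg_mul_rpow hp hk]
  have e1 : (p + 1) / p = 1 / p + 1 := by field_simp; ring
  have e2 : -(p + 1) / p = -1 / p - 1 := by field_simp; ring
  rw [e1, e2, rpow_sub_one hk.ne']
  field_simp

/-- Multiply the rescaled integral by `c = Λ^{1/p}`. As `Λ → ∞`, `c / (c + y) → 1` and `N / Λ → 0`,
so dominated convergence gives a limit that is negative when `p * k < 1`. -/
theorem exists_marginal_neg {p N k : ℝ} (hp : 0 < p) (hN : 0 ≤ N) (hk : 0 < k)
    (hpk : p * k < 1) : ∃ Λ, 0 < Λ ∧ marginal p N k Λ < 0 := by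
  obtain ⟨hi, he⟩ := setIntegral_one_sub_rpow_mul_exp hp hk
  have hneg : ∫ y in Ioi (0 : ℝ), (1 - y ^ p) * exp (-k * y ^ p) < 0 := by
    rw [he]
    refine mul_neg_of_pos_of_neg ?_ ?_
    · have := Gamma_pos_of_pos (s := 1 / p + 1) (by positivity)
      positivity
    · rw [sub_neg, div_div, lt_div_iff₀ (by positivity)]
      linarith
  have hlim : Tendsto (fun Λ : ℝ => ∫ y in Ioi (0 : ℝ),
      (1 - y ^ p) * exp (-(N / Λ + k) * y ^ p) * (Λ ^ p⁻¹ / (Λ ^ p⁻¹ + y))) atTop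
      (𝓝 (∫ y in Ioi (0 : ℝ), (1 - y ^ p) * exp (-k * y ^ p))) := by
    refine tendsto_integral_filter_of_dominated_convergence
      (fun y => |(1 - y ^ p) * exp (-k * y ^ p)|)
      (Eventually.of_forall fun Λ => Measurable.aestronglyMeasurable (by fun_prop)) ?_ hi.abs ?_
    · filter_upwards [eventually_gt_atTop 0] with Λ hΛ
      filter_upwards [ae_restrict_mem measurableSet_Ioi] with y hy
      have hy' : (0 : ℝ) < y := hy
      have hc : 0 < Λ ^ p⁻¹ := rpow_pos_of_pos hΛ _
      rw [norm_mul, norm_mul, abs_mul, norm_eq_abs, norm_eq_abs, norm_eq_abs, abs_exp, abs_exp,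
        abs_of_pos (div_pos hc (by linarith))]
      have h1 : Λ ^ p⁻¹ / (Λ ^ p⁻¹ + y) ≤ 1 := by
        rw [div_le_one (by linarith)]
        linarith
      have h2 : exp (-(N / Λ + k) * y ^ p) ≤ exp (-k * y ^ p) := by
        have : 0 ≤ N / Λ := by positivity
        gcongr
        linarith
      calc _ ≤ |1 - y ^ p| * exp (-(N / Λ + k) * y ^ p) * 1 := by gcongr
        _ ≤ _ := by rw [mul_one]; gcongr
    · filter_upwards [ae_restrict_mem measurableSet_Ioi] with y hy
      have hy' : (0 : ℝ) < y := hy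
      have hc : Tendsto (fun Λ : ℝ => Λ ^ p⁻¹) atTop atTop := tendsto_rpow_atTop (by positivity)
      have h1 : Tendsto (fun Λ : ℝ => Λ ^ p⁻¹ / (Λ ^ p⁻¹ + y)) atTop (𝓝 1) := by
        have h2 : Tendsto (fun c : ℝ => 1 - y / (c + y)) atTop (𝓝 (1 - 0)) :=
          tendsto_const_nhds.sub
            (tendsto_const_nhds.div_atTop (tendsto_atTop_add_const_right _ _ tendsto_id))
        rw [sub_zero] at h2
        refine (h2.comp hc).congr' ?_
        filter_upwards [eventually_gt_atTop 0] with Λ hΛ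
        have hc : 0 < Λ ^ p⁻¹ := rpow_pos_of_pos hΛ _
        simp only [Function.comp]
        field_simp
        ring
      have h3 : Tendsto (fun Λ : ℝ => -(N / Λ + k) * y ^ p) atTop (𝓝 (-(0 + k) * y ^ p)) :=
        (((tendsto_const_nhds.div_atTop tendsto_id).add_const k).neg).mul_const _
      rw [zero_add] at h3
      have h4 := (((continuous_exp.tendsto _).comp h3).const_mul (1 - y ^ p)).mul h1
      rw [mul_one] at h4
      exact h4
  obtain ⟨Λ, hΛ, h0⟩ := ((hlim.eventually_lt_const hneg).and (eventually_gt_atTop 0)).exists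
  refine ⟨Λ, h0, ?_⟩
  have hc : 0 < Λ ^ p⁻¹ := rpow_pos_of_pos h0 _
  rw [← (marginal_eq_scaled hp h0 (by positivity)).2]
  have h1 : ∀ y : ℝ, (1 - y ^ p) * exp (-(N / Λ + k) * y ^ p) * (Λ ^ p⁻¹ / (Λ ^ p⁻¹ + y))
      = Λ ^ p⁻¹ * ((1 - y ^ p) * exp (-(N / Λ + k) * y ^ p) / (Λ ^ p⁻¹ + y)) := fun y => by ring
  simp only [h1, integral_const_mul] at hΛ
  exact (pos_iff_neg_of_mul_neg hΛ).1 hc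

/-- The limiting integral is now nonnegative, and the weight `(1 + c) / (c + y)` raises its
integrand at every `y ≠ 1`: it exceeds `1` where `1 - y ^ p > 0` and is below `1` where `1 - y ^ p <
0`. -/
theorem marginal_zero_pos {p k Λ : ℝ} (hp : 0 < p) (hk : 0 < k) (hpk : 1 ≤ p * k) (hΛ : 0 < Λ) :
    0 < marginal p 0 k Λ := by
  obtain ⟨hi, he⟩ := setIntegral_one_sub_rpow_mul_exp hp hk
  have hnn : 0 ≤ ∫ y in Ioi (0 : ℝ), (1 - y ^ p) * exp (-k * y ^ p) := by
    rw [he]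
    refine mul_nonneg ?_ ?_
    · have := Gamma_pos_of_pos (s := 1 / p + 1) (by positivity)
      positivity
    · rw [sub_nonneg, div_div, div_le_one (by positivity)]
      exact hpk
  have hc : 0 < Λ ^ p⁻¹ := rpow_pos_of_pos hΛ _
  obtain ⟨hi', he'⟩ := marginal_eq_scaled (p := p) (N := 0) (k := k) hp hΛ (by positivity)
  have hlt := setIntegral_Ioi_lt hi (hi'.const_mul (1 + Λ ^ p⁻¹)) fun y hy hy1 => by
    have h1 : (1 + Λ ^ p⁻¹) * ((1 - y ^ p) * exp (-(0 / Λ + k) * y ^ p) / (Λ ^ p⁻¹ + y))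
        = exp (-k * y ^ p) * ((1 - y ^ p) * ((1 + Λ ^ p⁻¹) / (Λ ^ p⁻¹ + y))) := by
      rw [zero_div, zero_add]
      ring
    rw [h1, mul_comm (1 - y ^ p)]
    refine mul_lt_mul_of_pos_left ?_ (exp_pos _)
    rcases one_sub_rpow_sign hp hy hy1 with ⟨h2, h3⟩ | ⟨h2, h3⟩
    · refine lt_mul_of_one_lt_right h3 ?_
      rw [one_lt_div (by linarith)]
      linarith
    · refine lt_mul_of_lt_one_right h3 ?_
      rw [div_lt_one (by linarith)]
      linarith
  rw [integral_const_mul, he'] at hlt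
  exact (pos_iff_pos_of_mul_pos (hnn.trans_lt hlt)).1 (by positivity)

/-! ### Small densities and the single sign change. -/

/-- Replacing `1 / (1 + x)` by `1 / x` leaves an exact Gamma integral. -/
theorem mul_moment_self_le {p S : ℝ} (hp : 0 < p) (hS : 0 < S) : S * moment p p S ≤ 1 / p := by
  have h1 : moment p p S ≤ ∫ x in Ioi (0 : ℝ), x ^ (p - 1) * exp (-S * x ^ p) := by
    refine setIntegral_mono_on (integrableOn_moment hp hp.le hS)
      (integrableOn_rpow_mul_exp_neg_mul_rpow (by linarith) hp hS) measurableSet_Ioi fun x hx => ?_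
    have hx' : (0 : ℝ) < x := hx
    rw [rpow_sub_one hx'.ne', div_mul_eq_mul_div]
    gcongr
    linarith
  rw [integral_rpow_mul_exp_neg_mul_rpow hp (by linarith) hS] at h1
  have e1 : (p - 1 + 1) / p = 1 := by field_simp; ring
  have e2 : -(p - 1 + 1) / p = -1 := by field_simp; ring
  rw [e1, e2, Gamma_one, rpow_neg_one] at h1
  calc S * moment p p S ≤ S * (S⁻¹ * (1 / p) * 1) := by gcongr
    _ = 1 / p := by field_simp

/-- On `(0, T]` the exponent is at least `-1`. Hence the zeroth moment diverges logarithmically as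
the density tends to `0`. -/
theorem exp_mul_log_le_moment {p T : ℝ} (hp : 0 < p) (hT : 0 < T) :
    exp (-1) * log (1 + T) ≤ moment p 0 (T ^ p)⁻¹ := by
  have hTp : 0 < T ^ p := rpow_pos_of_pos hT _
  have hi := integrableOn_moment (p := p) (q := 0) hp le_rfl (inv_pos.2 hTp)
  have hlog : ∫ x in Ioc (0 : ℝ) T, (1 + x)⁻¹ = log (1 + T) := by
    rw [← intervalIntegral.integral_of_le hT.le,
      intervalIntegral.integral_comp_add_left (fun x => x⁻¹) 1,
      integral_inv_of_pos (by norm_num) (by linarith)]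
    simp
  rw [← hlog, ← integral_const_mul]
  refine le_trans ?_ (setIntegral_mono_set hi ?_ (s := Ioc 0 T) Ioc_subset_Ioi_self.eventuallyLE)
  · refine setIntegral_mono_on ?_ (hi.mono_set Ioc_subset_Ioi_self) measurableSet_Ioc fun x hx => ?_
    · refine (ContinuousOn.integrableOn_Icc (continuousOn_const.mul
        (ContinuousOn.inv₀ (by fun_prop) fun x hx => ?_))).mono_set Ioc_subset_Icc_self
      linarith [hx.1]
    · have hx0 : 0 < x := hx.1
      rw [rpow_zero, one_mul, ← div_eq_mul_inv]
      have : (T ^ p)⁻¹ * x ^ p ≤ 1 := by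
        rw [inv_mul_le_iff₀ hTp, mul_one]
        exact rpow_le_rpow hx0.le hx.2 hp.le
      gcongr
      linarith
  · filter_upwards [ae_restrict_mem measurableSet_Ioi] with x hx
    have hx' : (0 : ℝ) < x := hx
    positivity

theorem exists_marginal_pos {p N k : ℝ} (hp : 0 < p) (hN : 0 ≤ N) (hk : 0 < k) :
    ∃ Λ, 0 < Λ ∧ 0 < marginal p N k Λ := by
  -- For `N = 0` the integral diverges at `Λ = 0`, so continuity there is unavailable; instead the
  -- unbounded zeroth moment beats the bounded term `Λ * moment p p (k * Λ)`, with `k * Λ = (T ^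
  -- p)⁻¹`.
  rcases hN.eq_or_lt with rfl | hN
  · have h1 : Tendsto (fun T : ℝ => exp (-1) * log (1 + T)) atTop atTop :=
      (tendsto_log_atTop.comp (tendsto_atTop_add_const_left _ _ tendsto_id)).const_mul_atTop
        (exp_pos _)
    obtain ⟨T, h2, hT⟩ :=
      ((h1.eventually_gt_atTop (1 / k * (1 / p))).and (eventually_gt_atTop 0)).exists
    have hS : 0 < (T ^ p)⁻¹ := by positivity
    refine ⟨(T ^ p)⁻¹ / k, by positivity, ?_⟩
    have h3 := exp_mul_log_le_moment hp hT
    have h4 : 1 / k * ((T ^ p)⁻¹ * moment p p (T ^ p)⁻¹) ≤ 1 / k * (1 / p) := by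
      have := mul_moment_self_le hp hS
      gcongr
    unfold marginal
    rw [zero_add, mul_div_cancel₀ _ hk.ne']
    have h5 : (T ^ p)⁻¹ / k * moment p p (T ^ p)⁻¹
      = 1 / k * ((T ^ p)⁻¹ * moment p p (T ^ p)⁻¹) := by ring
    rw [h5]
    linarith
  · have hc : ContinuousOn (marginal p N k) (Ici 0) := continuousOn_marginal hp fun Λ hΛ => by
      have : (0 : ℝ) ≤ Λ := hΛ
      positivity
    have h0 : 0 < marginal p N k 0 := by
      simpa [marginal] using moment_pos (p := p) hp le_rfl hN
    have h1 := (hc 0 self_mem_Ici).mono Ioi_subset_Ici_self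
    obtain ⟨Λ, h2, h3⟩ := ((h1.eventually_const_lt h0).and self_mem_nhdsWithin).exists
    exact ⟨Λ, h3, h2⟩

/-- `marginal` changes sign exactly once. -/
theorem exists_marginal_sign {p N k : ℝ} (hp : 0 < p) (hN : 0 ≤ N) (hk : 0 < k)
    (hpk : p * k < 1) : ∃ r, 0 < r ∧ marginal p N k r = 0 ∧
      (∀ Λ, 0 < Λ → Λ < r → 0 < marginal p N k Λ) ∧ ∀ Λ, r < Λ → marginal p N k Λ < 0 := by
  obtain ⟨a, ha, ha'⟩ := exists_marginal_pos hp hN hk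
  obtain ⟨b, hb, hb'⟩ := exists_marginal_neg hp hN hk hpk
  have hab : a ≤ b := by
    by_contra! h
    exact (marginal_neg_of_lt hp hN hk hb h hb'.le).not_gt ha'
  have hc : ContinuousOn (marginal p N k) (Icc a b) := continuousOn_marginal hp fun Λ hΛ => by
    have : 0 < Λ := ha.trans_le hΛ.1
    positivity
  obtain ⟨r, hr, hr0⟩ := intermediate_value_Icc' hab hc ⟨hb'.le, ha'.le⟩
  have hr' : 0 < r := ha.trans_le hr.1
  refine ⟨r, hr', hr0, fun Λ h0 h1 => ?_, fun Λ h1 => marginal_neg_of_lt hp hN hk hr' h1 hr0.le⟩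
  by_contra! h
  exact (marginal_neg_of_lt hp hN hk h0 h1 h).ne hr0

/-! ### The defining equations as zeros of the marginal. -/

theorem rateIntegral_eq_moment (α S : ℝ) : rateIntegral α S = moment (2 / α) 0 S := by
  simp [rateIntegral, moment]

theorem not_integrableOn_one_div_one_add :
    ¬ IntegrableOn (fun x : ℝ => 1 / (1 + x)) (Ioi 0) := by
  intro h
  refine not_integrableOn_Ioi_inv (a := 1) ?_
  refine Integrable.mono' ((h.mono_set (Ioi_subset_Ioi zero_le_one)).const_mul 2)
    (Measurable.aestronglyMeasurable (by fun_prop)) ?_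
  filter_upwards [ae_restrict_mem measurableSet_Ioi] with x hx
  have hx' : (1 : ℝ) < x := hx
  rw [Real.norm_of_nonneg (by positivity), mul_one_div, inv_eq_one_div,
    div_le_div_iff₀ (by linarith) (by linarith)]
  linarith

/-- If `S ≤ 0` and `Λ ≤ 0`, the integrand dominates `1 / (1 + x)` and cannot converge. For `S = N +
k * Λ` with `N ≥ 0`, `S ≤ 0` forces `Λ ≤ 0`. -/
theorem pos_of_zeroIntegral {α S Λ : ℝ} (h : ZeroIntegral α S Λ) (hΛ : 0 < S ∨ Λ ≤ 0) :
    0 < S := by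
  by_contra! hS
  have hΛ : Λ ≤ 0 := hΛ.resolve_left hS.not_gt
  refine not_integrableOn_one_div_one_add (Integrable.mono' h.1
    (Measurable.aestronglyMeasurable (by fun_prop)) ?_)
  filter_upwards [ae_restrict_mem measurableSet_Ioi] with x hx
  have hx' : (0 : ℝ) < x := hx
  have hxp : 0 < x ^ (2 / α) := by positivity
  rw [Real.norm_of_nonneg (by positivity)]
  have h1 : 1 ≤ exp (-S * x ^ (2 / α)) := one_le_exp (by nlinarith)
  have h2 : 1 ≤ 1 - Λ * x ^ (2 / α) := by nlinarith
  have h3 : 1 / (1 + x) ≤ (1 - Λ * x ^ (2 / α)) / (1 + x) := by gcongr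
  exact h3.trans (le_mul_of_one_le_right (by positivity) h1)

theorem zeroIntegral_iff {α N k Λ : ℝ} (hα : 0 < α) (hN : 0 ≤ N) (hk : 0 < k) :
    ZeroIntegral α (N + k * Λ) Λ ↔ 0 < N + k * Λ ∧ marginal (2 / α) N k Λ = 0 := by
  have hp : 0 < 2 / α := by positivity
  constructor
  · intro h
    have hS : 0 < N + k * Λ := pos_of_zeroIntegral h (by
      by_contra! h1
      have : 0 < k * Λ := mul_pos hk h1.2
      linarith)
    exact ⟨hS, by rw [← (marginal_eq_setIntegral hp hS).2, h.2]⟩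
  · rintro ⟨hS, h⟩
    obtain ⟨h1, h2⟩ := marginal_eq_setIntegral hp hS
    exact ⟨h1, by rw [h2, h]⟩

theorem pos_of_marginal_eq_zero {p N k Λ : ℝ} (hp : 0 < p) (hS : 0 < N + k * Λ)
    (h : marginal p N k Λ = 0) : 0 < Λ := by
  have h1 := moment_pos hp le_rfl hS
  have h2 := moment_pos hp hp.le hS
  have h3 : moment p 0 (N + k * Λ) = Λ * moment p p (N + k * Λ) := sub_eq_zero.1 h
  exact pos_of_mul_pos_left (h3 ▸ h1) h2.le

/-- `r` is the unique sign change of `marginal p N k`. For `k = 1` it is where the payoff against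
the density `N` peaks. -/
structure IsPeak (p N k r : ℝ) : Prop where
  pos : 0 < r
  eq_zero : marginal p N k r = 0
  pos_of_lt : ∀ Λ, 0 < Λ → Λ < r → 0 < marginal p N k Λ
  neg_of_lt : ∀ Λ, r < Λ → marginal p N k Λ < 0

theorem exists_isPeak {p N k : ℝ} (hp : 0 < p) (hN : 0 ≤ N) (hk : 0 < k) (hpk : p * k < 1) :
    ∃ r, IsPeak p N k r := by
  obtain ⟨r, h1, h2, h3, h4⟩ := exists_marginal_sign hp hN hk hpk
  exact ⟨r, h1, h2, h3, h4⟩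

theorem IsPeak.le_iff {p N k r Λ : ℝ} (h : IsPeak p N k r) (hΛ : 0 < Λ) :
    Λ ≤ r ↔ 0 ≤ marginal p N k Λ := by
  constructor
  · intro h1
    rcases h1.eq_or_lt with rfl | h1
    · exact h.eq_zero.ge
    · exact (h.pos_of_lt Λ hΛ h1).le
  · intro h1
    by_contra! h2
    exact (h.neg_of_lt Λ h2).not_ge h1

theorem IsPeak.eq_of_eq_zero {p N k r Λ : ℝ} (h : IsPeak p N k r) (hΛ : 0 < Λ)
    (h0 : marginal p N k Λ = 0) : Λ = r := by
  refine le_antisymm ((h.le_iff hΛ).2 h0.ge) ?_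
  by_contra! h1
  exact (h.pos_of_lt Λ hΛ h1).ne' h0

theorem IsPeak.zeroIntegral_iff {α N k r Λ : ℝ} (h : IsPeak (2 / α) N k r) (hα : 0 < α)
    (hN : 0 ≤ N) (hk : 0 < k) : ZeroIntegral α (N + k * Λ) Λ ↔ Λ = r := by
  rw [VariableRate.zeroIntegral_iff hα hN hk]
  constructor
  · rintro ⟨hS, h0⟩
    exact h.eq_of_eq_zero (pos_of_marginal_eq_zero (by positivity) hS h0) h0
  · rintro rfl
    have := h.pos
    exact ⟨by positivity, h.eq_zero⟩

/-! ### Best responses and equilibria. -/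

theorem hasDerivAt_payoff {p N Λ : ℝ} (hp : 0 < p) (hS : 0 < Λ + N) :
    HasDerivAt (fun s => s * moment p 0 (s + N)) (marginal p N 1 Λ) Λ := by
  have h1 := (hasDerivAt_moment hp le_rfl hS).comp_add_const Λ N
  refine ((hasDerivAt_id Λ).mul h1).congr_deriv ?_
  simp only [marginal, id, zero_add, one_mul, add_comm N Λ]
  ring

/-- The best response against `N` under the cap `M` is `min r M`, and it is the only one. -/
theorem IsPeak.payoff_lt {p N r M s : ℝ} (h : IsPeak p N 1 r) (hp : 0 < p) (hN : 0 ≤ N)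
    (hM : 0 < M) (hs : s ∈ Icc 0 M) (hne : s ≠ min r M) :
    s * moment p 0 (s + N) < min r M * moment p 0 (min r M + N) := by
  have hr := h.pos
  have hm : 0 < min r M := lt_min hr hM
  have hd : ∀ x, 0 < x → HasDerivAt (fun s => s * moment p 0 (s + N)) (marginal p N 1 x) x :=
    fun x hx => hasDerivAt_payoff hp (by linarith)
  -- The endpoint `0` is treated separately, since differentiability fails to be available there
  -- when `N = 0`.
  rcases hs.1.eq_or_lt with rfl | hs0
  · rw [zero_mul]
    exact mul_pos hm (moment_pos hp le_rfl (by linarith))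
  rcases lt_or_ge r s with h1 | h1
  · have hanti : StrictAntiOn (fun s => s * moment p 0 (s + N)) (Ici r) := by
      refine strictAntiOn_of_deriv_neg (convex_Ici r)
        (fun x hx => (hd x (hr.trans_le hx)).continuousAt.continuousWithinAt) fun x hx => ?_
      rw [interior_Ici] at hx
      rw [(hd x (hr.trans hx)).deriv]
      exact h.neg_of_lt x hx
    rw [min_eq_left (h1.le.trans hs.2)]
    exact hanti self_mem_Ici h1.le h1
  · have hmono : StrictMonoOn (fun s => s * moment p 0 (s + N)) (Ioc 0 r) := by
      refine strictMonoOn_of_deriv_pos (convex_Ioc 0 r)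
        (fun x hx => (hd x hx.1).continuousAt.continuousWithinAt) fun x hx => ?_
      rw [interior_Ioc] at hx
      rw [(hd x hx.1).deriv]
      exact h.pos_of_lt x hx.1 hx.2
    exact hmono ⟨hs0, h1⟩ ⟨hm, min_le_left _ _⟩ (lt_of_le_of_ne (le_min h1 hs.2) hne)

theorem IsPeak.forall_payoff_le_iff {p N r M a : ℝ} (h : IsPeak p N 1 r) (hp : 0 < p)
    (hN : 0 ≤ N) (hM : 0 < M) (ha : a ∈ Icc 0 M) :
    (∀ s ∈ Icc 0 M, s * moment p 0 (s + N) ≤ a * moment p 0 (a + N)) ↔ a = min r M := by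
  constructor
  · intro h1
    by_contra h2
    exact (h.payoff_lt hp hN hM ha h2).not_ge
      (h1 _ ⟨(lt_min h.pos hM).le, min_le_right _ _⟩)
  · rintro rfl s hs
    rcases eq_or_ne s (min r M) with rfl | h2
    · exact le_rfl
    · exact (h.payoff_lt hp hN hM hs h2).le

theorem isVariableRateNash_iff {α N₁ N₂ : ℝ} {r : ℝ → ℝ} (hα : 0 < α)
    (hr : ∀ N, 0 ≤ N → IsPeak (2 / α) N 1 (r N)) (h1 : 0 < N₁) (h2 : 0 < N₂) (P : ℝ × ℝ) :
    IsVariableRateNash α N₁ N₂ P ↔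
      0 < P.1 ∧ 0 < P.2 ∧ P.1 = min (r P.2) N₁ ∧ P.2 = min (r P.1) N₂ := by
  have hp : 0 < 2 / α := by positivity
  constructor
  · rintro ⟨m1, m2, b1, b2⟩
    have e1 := ((hr P.2 m2.1).forall_payoff_le_iff hp m2.1 h1 m1).1 fun s hs => by
      simpa only [payoff₁, rateIntegral_eq_moment] using b1 s hs
    have e2 := ((hr P.1 m1.1).forall_payoff_le_iff hp m1.1 h2 m2).1 fun s hs => by
      simpa only [payoff₂, rateIntegral_eq_moment, add_comm] using b2 s hs
    refine ⟨?_, ?_, e1, e2⟩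
    · rw [e1]
      exact lt_min (hr _ m2.1).pos h1
    · rw [e2]
      exact lt_min (hr _ m1.1).pos h2
  · rintro ⟨p1, p2, e1, e2⟩
    have m1 : P.1 ∈ Icc 0 N₁ := ⟨p1.le, e1.trans_le (min_le_right _ _)⟩
    have m2 : P.2 ∈ Icc 0 N₂ := ⟨p2.le, e2.trans_le (min_le_right _ _)⟩
    refine ⟨m1, m2, fun s hs => ?_, fun s hs => ?_⟩
    · simpa only [payoff₁, rateIntegral_eq_moment] using
        ((hr P.2 m2.1).forall_payoff_le_iff hp m2.1 h1 m1).2 e1 s hs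
    · simpa only [payoff₂, rateIntegral_eq_moment, add_comm] using
        ((hr P.1 m1.1).forall_payoff_le_iff hp m1.1 h2 m2).2 e2 s hs

/-- Links the symmetric equation to best responses: both sides have total density `2 * x`. -/
theorem marginal_self (p x : ℝ) : marginal p x 1 x = marginal p 0 2 x := by
  simp only [marginal]
  ring_nf

/-- At total density `a + b` the two marginals differ by `(b - a) * moment p p (a + b)`. -/
theorem marginal_nonneg_of_le {p a b : ℝ} (hp : 0 < p) (ha : 0 < a) (hab : a ≤ b)
    (h : 0 ≤ marginal p a 1 b) : 0 ≤ marginal p b 1 a := by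
  have h1 := moment_pos (p := p) (q := p) (S := a + b) hp hp.le (by linarith)
  simp only [marginal, one_mul, add_comm b a] at h ⊢
  nlinarith

/-- If both players respond optimally, then either player 1 uses its cap, or the equilibrium is
symmetric and interior. -/
theorem nash_cases {p N₁ N₂ : ℝ} {r : ℝ → ℝ} (hp : 0 < p)
    (hr : ∀ N, 0 ≤ N → IsPeak p N 1 (r N)) (hN : N₁ ≤ N₂) {a b : ℝ} (ha : 0 < a) (hb : 0 < b)
    (h1 : a = min (r b) N₁) (h2 : b = min (r a) N₂) :
    (a = N₁ ∧ 0 ≤ marginal p 0 2 N₁) ∨ (a < N₁ ∧ b = a ∧ marginal p 0 2 a = 0) := by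
  have hm := moment_pos (p := p) (q := p) (S := a + b) hp hp.le (by linarith)
  have hDa : 0 ≤ marginal p b 1 a := ((hr b hb.le).le_iff ha).1 (h1.trans_le (min_le_left _ _))
  have hDb : 0 ≤ marginal p a 1 b := ((hr a ha.le).le_iff hb).1 (h2.trans_le (min_le_left _ _))
  have haN : a ≤ N₁ := h1.trans_le (min_le_right _ _)
  rcases haN.eq_or_lt with h | h
  · refine Or.inl ⟨h, ?_⟩
    rw [← h, ← marginal_self, ← (hr a ha.le).le_iff ha]
    by_contra! h3
    -- Here `r a < a ≤ N₂`, so player 2 is interior with zero marginal; player 1, having the larger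
    -- density, would have a negative one.
    have h4 : b = r a := by rw [h2, min_eq_left (by linarith)]
    have h5 : marginal p a 1 b = 0 := h4 ▸ (hr a ha.le).eq_zero
    simp only [marginal, one_mul, add_comm b a] at hDa h5
    nlinarith
  · refine Or.inr ⟨h, ?_⟩
    have h4 : a = r b := by
      rcases min_choice (r b) N₁ with h5 | h5
      · exact h1.trans h5
      · linarith
    have h5 : marginal p b 1 a = 0 := by
      have := (hr b hb.le).eq_zero
      rwa [← h4] at this
    have h6 : b ≤ a := by
      by_contra! h6
      simp only [marginal, one_mul, add_comm b a] at h5 hDb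
      nlinarith
    -- Since `b ≤ a < N₁ ≤ N₂`, the cap of player 2 does not bind, so both marginals vanish at the
    -- same total density and `a = b`.
    have h7 : b = r a := by
      rcases min_choice (r a) N₂ with h7 | h7
      · exact h2.trans h7
      · linarith
    have h8 : marginal p a 1 b = 0 := by
      have := (hr a ha.le).eq_zero
      rwa [← h7] at this
    have h9 : b = a := by
      simp only [marginal, one_mul, add_comm b a] at h5 h8
      have : (a - b) * moment p p (a + b) = 0 := by linarith
      rcases mul_eq_zero.1 this with h10 | h10 <;> linarith
    exact ⟨h9, by rw [← marginal_self]; rwa [h9] at h8⟩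

/-- Classification of the equilibrium when full use of the smaller cap is profitable. -/
theorem nash_iff_of_nonneg {α N₁ N₂ : ℝ} {r : ℝ → ℝ} (hα : 0 < α)
    (hr : ∀ N, 0 ≤ N → IsPeak (2 / α) N 1 (r N)) (h1 : 0 < N₁) (hN : N₁ ≤ N₂)
    (hnn : 0 ≤ marginal (2 / α) 0 2 N₁)
    (hpos : ∀ Λ, 0 < Λ → Λ < N₁ → marginal (2 / α) 0 2 Λ ≠ 0) (P : ℝ × ℝ) :
    IsVariableRateNash α N₁ N₂ P ↔ P = (N₁, min (r N₁) N₂) := by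
  have hp : 0 < 2 / α := by positivity
  rw [isVariableRateNash_iff hα hr h1 (h1.trans_le hN)]
  have hr1 := hr N₁ h1.le
  constructor
  · rintro ⟨p1, p2, e1, e2⟩
    rcases nash_cases hp hr hN p1 p2 e1 e2 with ⟨h3, -⟩ | ⟨h3, -, h4⟩
    · exact Prod.ext h3 (by rw [e2, h3])
    · exact absurd h4 (hpos _ p1 h3)
  · rintro rfl
    have hb : 0 < min (r N₁) N₂ := lt_min hr1.pos (h1.trans_le hN)
    refine ⟨h1, hb, ?_, rfl⟩
    -- This turns `hnn` into `N₁ ≤ r N₁`, so player 2 uses at least `N₁`; player 1 then has the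
    -- larger marginal, which is nonnegative, and its cap is optimal.
    rw [← marginal_self, ← hr1.le_iff h1] at hnn
    refine (min_eq_right (((hr _ hb.le).le_iff h1).2 ?_)).symm
    exact marginal_nonneg_of_le hp h1 (le_min hnn hN) ((hr1.le_iff hb).1 (min_le_left _ _))

/-- Classification of the equilibrium when the symmetric solution lies below both caps. -/
theorem nash_iff_of_lt {α N₁ N₂ L : ℝ} {r : ℝ → ℝ} (hα : 0 < α)
    (hr : ∀ N, 0 ≤ N → IsPeak (2 / α) N 1 (r N)) (hN : N₁ ≤ N₂)
    (hL : IsPeak (2 / α) 0 2 L) (hLN : L < N₁) (P : ℝ × ℝ) :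
    IsVariableRateNash α N₁ N₂ P ↔ P = (L, L) := by
  have hp : 0 < 2 / α := by positivity
  have hL0 := hL.pos
  rw [isVariableRateNash_iff hα hr (hL0.trans hLN) (by linarith)]
  constructor
  · rintro ⟨p1, p2, e1, e2⟩
    rcases nash_cases hp hr hN p1 p2 e1 e2 with ⟨-, h3⟩ | ⟨-, h3, h4⟩
    · exact absurd h3 (hL.neg_of_lt _ hLN).not_ge
    · have := hL.eq_of_eq_zero p1 h4
      exact Prod.ext this (h3.trans this)
  · rintro rfl
    have h1 : L = r L :=
      (hr L hL0.le).eq_of_eq_zero hL0 (by rw [marginal_self, hL.eq_zero])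
    refine ⟨hL0, hL0, ?_, ?_⟩
    · rw [← h1, min_eq_left hLN.le]
    · rw [← h1, min_eq_left (by linarith)]

end VariableRate

theorem mainTheorem3 (α : ℝ) (hα : 2 < α) :
    ∃ Λdd : EReal,
      -- `Λdd` is `Λ''(α)`: the unique solution of the symmetric equation if `4 < α`, else `+∞`
      (4 < α → ∃ L : ℝ, Λdd = (L : EReal) ∧ 0 < L ∧ SolvesSymmetricEq α L ∧
        ∀ L' : ℝ, SolvesSymmetricEq α L' → L' = L) ∧
      (α ≤ 4 → Λdd = ⊤ ∧ ¬ ∃ L : ℝ, SolvesSymmetricEq α L) ∧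
      ∀ N₁ N₂ : ℝ, 0 < N₁ → N₁ ≤ N₂ →
        ∃ Λr : ℝ,
          -- `Λr` is the unique solution of the response equation
          0 < Λr ∧ SolvesResponseEq α N₁ Λr ∧
          (∀ Λ : ℝ, SolvesResponseEq α N₁ Λ → Λ = Λr) ∧
          -- there is exactly one equilibrium
          ∃ P : ℝ × ℝ, IsVariableRateNash α N₁ N₂ P ∧
            (∀ Q : ℝ × ℝ, IsVariableRateNash α N₁ N₂ Q → Q = P) ∧
            -- full/full reuse
            ((N₁ : EReal) ≤ Λdd → N₂ ≤ Λr → P = (N₁, N₂)) ∧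
            -- full/partial reuse
            ((N₁ : EReal) ≤ Λdd → Λr < N₂ → P = (N₁, Λr)) ∧
            -- partial/partial reuse
            (Λdd < (N₁ : EReal) → (P.1 : EReal) = Λdd ∧ (P.2 : EReal) = Λdd) := by
  have hα0 : 0 < α := by linarith
  have hp : 0 < 2 / α := by positivity
  -- The condition `0 ≤ N` sits under the existential so that `choose` gives a function on all of
  -- `ℝ`; its value at negative `N` is irrelevant.
  have hex : ∀ N : ℝ, ∃ r, 0 ≤ N → VariableRate.IsPeak (2 / α) N 1 r := fun N => by
    by_cases hN : 0 ≤ N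
    · obtain ⟨r, hr⟩ := VariableRate.exists_isPeak hp hN one_pos
        (by rw [mul_one, div_lt_one hα0]; exact hα)
      exact ⟨r, fun _ => hr⟩
    · exact ⟨0, fun h => absurd h hN⟩
  choose r hr using hex
  have hresp : ∀ N₁ : ℝ, 0 < N₁ → ∀ Λ, SolvesResponseEq α N₁ Λ ↔ Λ = r N₁ := fun N₁ h1 Λ => by
    have := (hr N₁ h1.le).zeroIntegral_iff (Λ := Λ) hα0 h1.le one_pos
    rwa [one_mul] at this
  have hfull : ∀ N₁ N₂ : ℝ, 0 < N₁ → N₁ ≤ N₂ → 0 ≤ VariableRate.marginal (2 / α) 0 2 N₁ →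
      (∀ Λ, 0 < Λ → Λ < N₁ → VariableRate.marginal (2 / α) 0 2 Λ ≠ 0) →
      ∃ P : ℝ × ℝ, IsVariableRateNash α N₁ N₂ P ∧
        (∀ Q : ℝ × ℝ, IsVariableRateNash α N₁ N₂ Q → Q = P) ∧
        (N₂ ≤ r N₁ → P = (N₁, N₂)) ∧ (r N₁ < N₂ → P = (N₁, r N₁)) := by
    intro N₁ N₂ h1 hN hnn hne
    have hiff := VariableRate.nash_iff_of_nonneg hα0 hr h1 hN hnn hne
    refine ⟨_, (hiff _).2 rfl, fun Q => (hiff Q).1, fun h => ?_, fun h => ?_⟩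
    · rw [min_eq_right h]
    · rw [min_eq_left h.le]
  -- With `k = 2`, `p * k = 4 / α`, which crosses `1` at `α = 4`.
  rcases lt_or_ge 4 α with h4 | h4
  · obtain ⟨L, hL⟩ := VariableRate.exists_isPeak (k := 2) hp le_rfl two_pos
      (by rw [div_mul_eq_mul_div, div_lt_one hα0]; linarith)
    have hsym : ∀ Λ, SolvesSymmetricEq α Λ ↔ Λ = L := fun Λ => by
      have := hL.zeroIntegral_iff (Λ := Λ) hα0 le_rfl two_pos
      rwa [zero_add] at this
    refine ⟨L, fun _ => ⟨L, rfl, hL.pos, (hsym L).2 rfl, fun L' => (hsym L').1⟩,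
      fun h => absurd h h4.not_ge, fun N₁ N₂ h1 hN => ⟨r N₁, (hr N₁ h1.le).pos,
        (hresp N₁ h1 _).2 rfl, fun Λ => (hresp N₁ h1 Λ).1, ?_⟩⟩
    simp only [EReal.coe_le_coe_iff, EReal.coe_lt_coe_iff, EReal.coe_eq_coe_iff]
    rcases le_or_gt N₁ L with h | h
    · obtain ⟨P, hP, hQ, h5, h6⟩ := hfull N₁ N₂ h1 hN ((hL.le_iff h1).1 h)
        fun Λ h0 h7 => (hL.pos_of_lt Λ h0 (h7.trans_le h)).ne'
      exact ⟨P, hP, hQ, fun _ => h5, fun _ => h6, fun h8 => absurd h h8.not_ge⟩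
    · have hiff := VariableRate.nash_iff_of_lt hα0 hr hN hL h
      exact ⟨(L, L), (hiff _).2 rfl, fun Q => (hiff Q).1, fun h8 => absurd h h8.not_gt,
        fun h8 => absurd h h8.not_gt, fun _ => ⟨rfl, rfl⟩⟩
  · have hpos : ∀ Λ, 0 < Λ → 0 < VariableRate.marginal (2 / α) 0 2 Λ := fun Λ =>
      VariableRate.marginal_zero_pos hp two_pos
        (by rw [div_mul_eq_mul_div, one_le_div hα0]; linarith)
    refine ⟨⊤, fun h => absurd h h4.not_gt, fun _ => ⟨rfl, ?_⟩, fun N₁ N₂ h1 hN =>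
      ⟨r N₁, (hr N₁ h1.le).pos, (hresp N₁ h1 _).2 rfl, fun Λ => (hresp N₁ h1 Λ).1, ?_⟩⟩
    · rintro ⟨L, hL⟩
      have := VariableRate.zeroIntegral_iff (Λ := L) hα0 le_rfl two_pos
      rw [zero_add] at this
      obtain ⟨hS, h0⟩ := this.1 hL
      exact (hpos L (by linarith)).ne' h0
    · obtain ⟨P, hP, hQ, h5, h6⟩ := hfull N₁ N₂ h1 hN (hpos N₁ h1).le
        fun Λ h0 _ => (hpos Λ h0).ne'
      exact ⟨P, hP, hQ, fun _ => h5, fun _ => h6, fun h8 => absurd h8 not_top_lt⟩
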